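/- Conventions. A cardinal is identified with the set of ordinals below it, and $[\lambda]^2$ is the set of two-element subsets of $\lambda$. For cardinals $\lambda,\mu,\sigma,\theta_0,\theta_1$ with $\lambda\ge\mu\ge\sigma+\theta_0+\theta_1$, the statement $\mathrm{Pr}_1(\lambda,\mu,\sigma,(\theta_0,\theta_1))$ means: there is a colouring $c:[\lambda]^2\to\sigma$ such that, whenever $i_0<\theta_0$ and $i_1<\theta_1$ are ordinals, $\langle\zeta^0_{\alpha,i}:\alpha<\mu,\ i<i_0\rangle$ and $\langle\zeta^1_{\alpha,i}:\alpha<\mu,\ i<i_1\rangle$ are two families of ordinals below $\lambda$, each without repetitions and with ranges disjoint from each other, and $\gamma<\sigma$, there are $\alpha_0<\alpha_1<\mu$ such that $c\{\zeta^0_{\alpha_0,j_0},\zeta^1_{\alpha_1,j_1}\}=\gamma$ for all $j_0<i_0$ and all $j_1<i_1$. Theorem. Let $\lambda=\partial^+$, where $\partial>\theta_1>\theta_0\ge\aleph_0$ are regular cardinals. Then $\mathrm{Pr}_1(\lambda,\lambda,\lambda,(\theta_0,\theta_1))$ holds. Moreover, in the formulation by sets, there is a colouring $c:[\lambda]^2\to\lambda$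 such that the following holds. Let $t^0_\alpha,t^1_\alpha\subseteq\lambda$ $(\alpha<\lambda)$ be sets with $|t^0_\alpha|<\theta_0$ and $|t^1_\alpha|<\theta_1$ such that the sets $t_\alpha=t^0_\alpha\cup t^1_\alpha$ $(\alpha<\lambda)$ are pairwise disjoint, and let $j<\lambda$. Then there are $\alpha_0<\alpha_1<\lambda$ such that $c\{\zeta_0,\zeta_1\}=j$ for all $\zeta_0\in t^0_{\alpha_0}$ and all $\zeta_1\in t^1_{\alpha_1}$. -/

import Mathlib

universe u

/-- The set `[A]²` of unordered pairs of distinct elements of `A`. -/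
abbrev UnorderedPairs (A : Type*) : Type _ := {p : Sym2 A // ¬ p.IsDiag}

/-- The unordered pair `{a, b} ∈ [A]²`, for `a ≠ b`. -/
def unorderedPair {A : Type*} (a b : A) (h : a ≠ b) : UnorderedPairs A :=
  ⟨s(a, b), fun hd => h (Sym2.mk_isDiag_iff.mp hd)⟩

/-- The colouring `c : [lam]² → sig` witnesses `Pr₁(lam, mu, sig, (th0, th1))`.
For a cardinal `κ`, the type `κ.ord.ToType` is the well-ordered set of the ordinals below `κ`,
and for an ordinal `i`, the type `i.ToType` is the well-ordered set of the ordinals below `i`.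
Given ordinals `i₀ < th0` and `i₁ < th1`, for `ι = 0, 1` a family `⟨ζ^ι_{α,i} : α < mu, i < i_ι⟩`
of ordinals below `lam` without repetitions, the ranges of the two families being disjoint, and a
colour `γ < sig`, there are `α₀ < α₁ < mu` such that `c {ζ⁰_{α₀,j₀}, ζ¹_{α₁,j₁}} = γ` for all
`j₀ < i₀` and `j₁ < i₁`. -/
def WitnessesPrOne (lam mu sig th0 th1 : Cardinal.{u})
    (c : UnorderedPairs lam.ord.ToType → sig.ord.ToType) : Prop :=
  ∀ i₀ i₁ : Ordinal.{u}, i₀ < th0.ord → i₁ < th1.ord →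
    ∀ (z₀ : mu.ord.ToType → i₀.ToType → lam.ord.ToType)
      (z₁ : mu.ord.ToType → i₁.ToType → lam.ord.ToType),
      Function.Injective (fun p : mu.ord.ToType × i₀.ToType => z₀ p.1 p.2) →
      Function.Injective (fun p : mu.ord.ToType × i₁.ToType => z₁ p.1 p.2) →
      (∀ α j₀ β j₁, z₀ α j₀ ≠ z₁ β j₁) →
      ∀ γ : sig.ord.ToType,
        ∃ α₀ α₁ : mu.ord.ToType, α₀ < α₁ ∧
          ∀ (j₀ : i₀.ToType) (j₁ : i₁.ToType),
            ∃ h : z₀ α₀ j₀ ≠ z₁ α₁ j₁, c (unorderedPair (z₀ α₀ j₀) (z₁ α₁ j₁) h) = γ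

/-- The principle `Pr₁(lam, mu, sig, (th0, th1))`
(considered for `lam ≥ mu ≥ sig + th0 + th1`). -/
def PrOne (lam mu sig th0 th1 : Cardinal.{u}) : Prop :=
  ∃ c : UnorderedPairs lam.ord.ToType → sig.ord.ToType,
    WitnessesPrOne lam mu sig th0 th1 c

/-!
Write `κ` for `del` and `θ` for `th1`, an uncountable regular cardinal below `κ`; it suffices to treat
the families `t α = t₀ α ∪ t₁ α`, whose members have fewer than `θ` elements.

Fix injections `e β` of the segments below `β < κ⁺` into `κ`, and walk from `β` down to `α` by always
passing to the `e β`-least point of `[α, β)`. If `x` has cofinality `κ`, then the walk from any `β ≥ x`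
to any `α < x` close enough to `x` goes through `x` (`walk_append_of_highCof`). By Ulam's splitting
(`MeetsClosure.exists_two_labels`) the points of cofinality `κ` carry labels `g < θ` and `h < κ⁺` such
that every pair of values is taken on a stationary set.

Given a family of sets `s y` above `y`, each of size less than `θ`, Fodor's lemma yields unboundedly
many `μ` such that all labels `g` on the walks from `s μ` to `μ` lie below a fixed `b`, and, enlarging `b`,
unboundedly many `x` such that, for cofinally many `y < x`, all labels `g` on the walks from `x` to
`s y` lie below `b`. Choose `x < m < μ` with `g m ≥ b` and `h m = j`. A walk from `β ∈ s μ` to `α ∈ s y` is the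
concatenation of a walk from `β` to `μ`, the walk from `μ` to `x` through `m`, and a walk from `x` to
`α`; only the middle part contains labels `g ≥ b`. Hence the first maximum of `g` on the whole walk
lies on the middle part and does not depend on `α` and `β`, and `m` lies at a distance `n` from it that
does not depend on them either. So the colouring "the value of `h` at distance `n` from the first
maximum of `g`" is constantly `j` on `s y × s μ` (`exists_anchored_color`).

The distance `n` depends on the family and on `j`, but it ranges over a countable set. As `θ` is
regular and uncountable, countably many families can be united into one, so some `n` works for all
families simultaneously once `j` is fixed. One `n` serves `κ⁺` many colours `j`, and renaming these
colours gives the required colouring (`exists_uniform_coloring`).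
-/

open Cardinal Set

/-! ### Strict upper bounds of small families -/

section Directed

/-- Every family of fewer than `κ` elements of `X` has a strict upper bound. -/
def StrictlyDirected (κ : Cardinal.{u}) (X : Type u) [LT X] : Prop :=
  ∀ (ι : Type u) (f : ι → X), #ι < κ → ∃ y, ∀ i, f i < y

theorem StrictlyDirected.set {κ : Cardinal.{u}} {X : Type u} [LT X] (h : StrictlyDirected κ X)
    (A : Set X) (hA : #A < κ) : ∃ y, ∀ a ∈ A, a < y := by
  obtain ⟨y, hy⟩ := h A (fun a => a.1) hA
  exact ⟨y, fun a ha => hy ⟨a, ha⟩⟩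

theorem strictlyDirected_toType {κ : Cardinal.{u}} (hκ : κ.IsRegular) :
    StrictlyDirected κ κ.ord.ToType := by
  intro ι f hι
  have : NoMaxOrder κ.ord.ToType := Cardinal.noMaxOrder hκ.aleph0_le
  by_contra! hc
  have hcof : IsCofinal (range f) := by
    intro y
    obtain ⟨i, hi⟩ := hc y
    exact ⟨f i, mem_range_self i, hi⟩
  have h1 := Order.cof_le hcof
  rw [Ordinal.cof_toType, hκ.cof_ord] at h1
  exact absurd (h1.trans mk_range_le) (not_le.mpr hι)

end Directed

/-! ### Stationary sets, pigeonhole principles and Ulam's splitting -/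

section Stationary

variable {Λ : Type u} [LinearOrder Λ]

/-- The points of `Λ` of cofinality at least `κ`: any fewer than `κ` points below `x` have a strict
upper bound below `x`. Successors and the least point are excluded. -/
def highCof (κ : Cardinal.{u}) (Λ : Type u) [LinearOrder Λ] : Set Λ :=
  {x | ∀ A : Set Λ, A ⊆ Iio x → #A < κ → ∃ y < x, ∀ a ∈ A, a < y}

/-- Stationarity, phrased with closure points of functions instead of closed unbounded sets: `T`
contains a closure point of every `F : Λ → Λ`. The least point of `Λ` is a closure point of every
function, so the notion is meaningful only for sets `T` that omit it. -/
def MeetsClosure (T : Set Λ) : Prop :=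
  ∀ F : Λ → Λ, ∃ x ∈ T, ∀ y < x, F y < x

theorem highCof_family {κ : Cardinal.{u}} {x : Λ} (hx : x ∈ highCof κ Λ) {ι : Type u} (f : ι → Λ)
    (hι : #ι < κ) (hf : ∀ i, f i < x) : ∃ y < x, ∀ i, f i < y := by
  obtain ⟨y, hy, h⟩ := hx (range f) (by rintro _ ⟨i, rfl⟩; exact hf i) (mk_range_le.trans_lt hι)
  exact ⟨y, hy, fun i => h _ (mem_range_self i)⟩

theorem exists_lt_of_mem_highCof {κ : Cardinal.{u}} (hκ : 0 < κ) {x : Λ} (hx : x ∈ highCof κ Λ) :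
    ∃ y, y < x := by
  obtain ⟨y, hy, -⟩ := hx ∅ (empty_subset _) (by simpa using hκ)
  exact ⟨y, hy⟩

/-- The set of points of cofinality `κ` in `κ⁺` is stationary: the supremum of a `κ`-sequence in which
each term dominates the values of `F` up to the earlier terms is a closure point of `F`. -/
theorem meetsClosure_highCof [WellFoundedLT Λ] {D : Type u} [LinearOrder D] [WellFoundedLT D] {κ : Cardinal.{u}}
    (hκ : ℵ₀ ≤ κ) (hΛ : StrictlyDirected (Order.succ κ) Λ) (hseg : ∀ x : Λ, #(Iio x) ≤ κ)
    (hD : StrictlyDirected κ D) (hDcard : #D = κ) (hDseg : ∀ d : D, #(Iio d) < κ) :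
    MeetsClosure (highCof κ Λ) := by
  intro F
  have hG : ∀ z : Λ, ∃ w, ∀ y ≤ z, F y < w ∧ z < w := by
    intro z
    have hz : #(Iic z) ≤ κ := by
      rw [← Iio_insert]
      exact (mk_insert_le).trans ((add_le_add_left (hseg z) 1).trans
        (by rw [add_one_eq hκ]))
    obtain ⟨w, hw⟩ := hΛ (Iic z) (fun y => max (F y) z) (Order.lt_succ_iff.mpr hz)
    exact ⟨w, fun y hy => max_lt_iff.mp (hw ⟨y, hy⟩)⟩
  choose G hG using hG
  have hU : ∀ (d : D) (f : Iio d → Λ), ∃ w, ∀ i, G (f i) < w := fun d f =>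
    hΛ (Iio d) (fun i => G (f i)) (Order.lt_succ_iff.mpr (hDseg d).le)
  choose U hU using hU
  -- A sequence of length `κ` in which each term exceeds `G` of all earlier ones.
  let f : D → Λ := WellFounded.fix (C := fun _ => Λ) (wellFounded_lt (α := D))
    (fun d r => U d (fun i => r i.1 i.2))
  have hf : ∀ d d' : D, d' < d → G (f d') < f d := by
    intro d d' h
    have h1 : f d = U d (fun i => f i.1) := WellFounded.fix_eq _ _ d
    rw [h1]
    exact hU d (fun i => f i.1) ⟨d', h⟩
  have hne : {x : Λ | ∀ d, f d < x}.Nonempty :=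
    hΛ D f (by rw [hDcard]; exact Order.lt_succ κ)
  let x := (wellFounded_lt (α := Λ)).min _ hne
  have hx : ∀ d, f d < x := (wellFounded_lt (α := Λ)).min_mem _ hne
  have hlt : ∀ y < x, ∃ d, y ≤ f d := by
    intro y hy
    by_contra! hc
    exact (wellFounded_lt (α := Λ)).not_lt_min {x : Λ | ∀ d, f d < x} hc hy
  refine ⟨x, ?_, ?_⟩
  · intro A hA hAc
    choose d hd using fun a : A => hlt a.1 (hA a.2)
    obtain ⟨d', hd'⟩ := hD A d hAc
    refine ⟨f d', hx d', fun a ha => ?_⟩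
    exact (hd ⟨a, ha⟩).trans_lt (((hG _ _ le_rfl).2).trans (hf _ _ (hd' ⟨a, ha⟩)))
  · intro y hy
    obtain ⟨d, hd⟩ := hlt y hy
    obtain ⟨d', hd'⟩ := hD PUnit (fun _ => d) (by simpa using one_lt_aleph0.trans_le hκ)
    exact ((hG _ _ hd).1).trans ((hf _ _ (hd' ⟨⟩)).trans (hx d'))

theorem MeetsClosure.exists_gt {T : Set Λ} (hT : MeetsClosure T) (hpos : ∀ x ∈ T, ∃ y, y < x)
    (F : Λ → Λ) (b : Λ) : ∃ x ∈ T, b < x ∧ ∀ y < x, F y < x := by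
  obtain ⟨x, hx, h⟩ := hT (fun y => max (F y) b)
  obtain ⟨y, hy⟩ := hpos x hx
  exact ⟨x, hx, (max_lt_iff.mp (h y hy)).2, fun y hy => (max_lt_iff.mp (h y hy)).1⟩

/-- Pigeonhole for at most `κ` classes. -/
theorem MeetsClosure.exists_fiber {κ : Cardinal.{u}} (hΛ : StrictlyDirected (Order.succ κ) Λ)
    {T : Set Λ} (hT : MeetsClosure T) {ι : Type u} (hι : #ι ≤ κ) (f : Λ → ι) :
    ∃ i, MeetsClosure {x ∈ T | f x = i} := by
  by_contra! hc
  simp only [MeetsClosure, not_forall] at hc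
  choose F hF using hc
  choose G hG using fun y => hΛ ι (fun i => F i y) (Order.lt_succ_iff.mpr hι)
  obtain ⟨x, hx, h⟩ := hT G
  exact hF (f x) ⟨x, ⟨hx, rfl⟩, fun y hy => (hG y _).trans (h y hy)⟩

/-- Fodor's lemma, combined with the pigeonhole principle for at most `κ` classes; only the
unboundedness of the resulting set is retained. -/
theorem MeetsClosure.exists_unbounded {κ : Cardinal.{u}}
    (hΛ : StrictlyDirected (Order.succ κ) Λ) {T : Set Λ} (hT : MeetsClosure T)
    {ι : Type u} (hι : #ι ≤ κ) (f : Λ → ι) (φ : Λ → Λ) (hφ : ∀ x ∈ T, φ x < x) :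
    ∃ i ε, ∀ z, ∃ x ∈ T, z < x ∧ f x = i ∧ φ x = ε := by
  by_contra! hc
  choose B hB using hc
  choose G hG using fun y => hΛ ι (fun i => B i y) (Order.lt_succ_iff.mpr hι)
  obtain ⟨x, hx, h⟩ := hT G
  exact hB (f x) (φ x) x hx ((hG (φ x) (f x)).trans (h _ (hφ x hx))) rfl rfl

/-- Ulam's splitting of a stationary set into `#Λ` stationary pieces, here the fibres of `G` over
the points of `Z`. -/
theorem MeetsClosure.exists_splitting {D : Type u} {κ : Cardinal.{u}} (hκ : ℵ₀ ≤ κ)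
    (hΛ : StrictlyDirected (Order.succ κ) Λ) (hΛcard : #Λ = Order.succ κ) (hDcard : #D ≤ κ)
    (e : Λ → Λ → D) (he : ∀ x, InjOn (e x) (Iio x)) {T : Set Λ} (hT : MeetsClosure T)
    (hpos : ∀ x ∈ T, ∃ y, y < x) :
    ∃ (G : Λ → Λ) (Z : Set Λ), #Z = #Λ ∧ ∀ α ∈ Z, MeetsClosure {x ∈ T | G x = α} := by
  have h1 : ∀ α : Λ, MeetsClosure {x ∈ T | α < x} := fun α F => by
    obtain ⟨x, hx, hb, h⟩ := hT.exists_gt hpos F α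
    exact ⟨x, ⟨hx, hb⟩, h⟩
  -- For each `α`, the value `e x α` is constant on a stationary set of `x`; many `α` share that value,
  -- and a point `x` determines `α` from it because `e x` is injective.
  choose i hi using fun α => (h1 α).exists_fiber hΛ hDcard (fun x => e x α)
  have hreg := isRegular_succ hκ
  obtain ⟨d, hd⟩ := infinite_pigeonhole i (by rw [hΛcard]; exact hreg.aleph0_le)
    (by rw [hΛcard, hreg.cof_ord]; exact Order.lt_succ_iff.mpr hDcard)
  classical
  refine ⟨fun x => if h : ∃ α < x, e x α = d then h.choose else x, i ⁻¹' {d}, hd, ?_⟩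
  intro α hα F
  obtain ⟨x, ⟨⟨hxT, hαx⟩, hx⟩, hF⟩ := hi α F
  have hα' : i α = d := hα
  have hex : ∃ α < x, e x α = d := ⟨α, hαx, hx.trans hα'⟩
  refine ⟨x, ⟨hxT, ?_⟩, hF⟩
  simp only [dif_pos hex]
  exact he x hex.choose_spec.1 hαx (hex.choose_spec.2.trans (hx.trans hα').symm)

/-- A stationary set `T` carries two labels, with values in `Θ` and `Λ`, such that each pair of values
is taken on a stationary subset of `T`. -/
theorem MeetsClosure.exists_two_labels {D Θ : Type u} [Nonempty Θ] {κ : Cardinal.{u}}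
    (hκ : ℵ₀ ≤ κ) (hΛ : StrictlyDirected (Order.succ κ) Λ) (hΛcard : #Λ = Order.succ κ)
    (hDcard : #D ≤ κ) (e : Λ → Λ → D) (he : ∀ x, InjOn (e x) (Iio x)) (hΘ : #Θ ≤ κ)
    {T : Set Λ} (hT : MeetsClosure T) (hpos : ∀ x ∈ T, ∃ y, y < x) :
    ∃ (g : Λ → Θ) (h : Λ → Λ), ∀ ζ j, MeetsClosure {x ∈ T | g x = ζ ∧ h x = j} := by
  obtain ⟨G, Z, hZ, hG⟩ := hT.exists_splitting hκ hΛ hΛcard hDcard e he hpos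
  have hinf : ℵ₀ ≤ #Λ := by rw [hΛcard]; exact hκ.trans (Order.le_succ κ)
  have hcard : #(Θ × Λ) ≤ #Z := by
    rw [mk_prod, lift_id, lift_id, hZ]
    exact mul_le_of_le hinf (by rw [hΛcard]; exact hΘ.trans (Order.le_succ κ)) le_rfl
  obtain ⟨f⟩ := hcard
  have : Nonempty Λ := mk_ne_zero_iff.mp (aleph0_pos.trans_le hinf).ne'
  have hinj : Function.Injective (fun p => (f p : Λ)) := Subtype.val_injective.comp f.injective
  have hinv := Function.leftInverse_invFun hinj
  refine ⟨fun x => (Function.invFun (fun p => (f p : Λ)) (G x)).1,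
    fun x => (Function.invFun (fun p => (f p : Λ)) (G x)).2, fun ζ j F => ?_⟩
  obtain ⟨x, ⟨hxT, hx⟩, hF⟩ := hG (f (ζ, j)) (f (ζ, j)).2 F
  have := hinv (ζ, j)
  refine ⟨x, ⟨hxT, ?_, ?_⟩, hF⟩ <;> simp only [hx, this]

end Stationary

/-! ### Walks -/

section Walks

variable {Λ D : Type u} [LinearOrder Λ] [LinearOrder D] [WellFoundedLT D]

/-- One step of the walk from `β` down to `α`: the point of `[α, β)` with the least `e β`-value. -/
noncomputable def walkStep (e : Λ → Λ → D) (β α : Λ) (h : α < β) : Λ :=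
  Function.argminOn (e β) (Ico α β) ⟨α, le_rfl, h⟩

theorem walkStep_mem (e : Λ → Λ → D) {β α : Λ} (h : α < β) : walkStep e β α h ∈ Ico α β :=
  Function.argminOn_mem _ _ _

theorem walkStep_le (e : Λ → Λ → D) {β α γ : Λ} (h : α < β) (hγ : γ ∈ Ico α β) :
    e β (walkStep e β α h) ≤ e β γ :=
  Function.argminOn_le _ _ hγ

open Classical in
/-- The walk from `β` down to `α`, as a list that starts with `β` and omits the final point `α`. -/
noncomputable def walk [WellFoundedLT Λ] (e : Λ → Λ → D) (β α : Λ) : List Λ :=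
  if h : α < β then β :: walk e (walkStep e β α h) α else []
termination_by (wellFounded_lt (α := Λ)).wrap β
decreasing_by exact (walkStep_mem e h).2

theorem walk_of_lt [WellFoundedLT Λ] (e : Λ → Λ → D) {β α : Λ} (h : α < β) :
    walk e β α = β :: walk e (walkStep e β α h) α := by
  rw [walk, dif_pos h]

theorem walk_self [WellFoundedLT Λ] (e : Λ → Λ → D) (α : Λ) : walk e α α = [] := by
  rw [walk, dif_neg (lt_irrefl α)]

/-- The first step from `β` towards `α` is the first step towards `x`, when `α` is just below a point
`x` of high cofinality. -/
theorem walkStep_eq_of_highCof {κ : Cardinal.{u}} (hDseg : ∀ d : D, #(Iio d) < κ)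
    {e : Λ → Λ → D} (he : ∀ x, InjOn (e x) (Iio x)) {x β : Λ} (hx : x ∈ highCof κ Λ)
    (hβ : x < β) : ∃ ε < x, ∀ α (_ : ε < α) (h : α < x),
      walkStep e β α (h.trans hβ) = walkStep e β x hβ := by
  set c := walkStep e β x hβ with hc
  have hcm : c ∈ Ico x β := walkStep_mem e hβ
  -- Points below `x` that could replace `c` inject into the segment of `D` below `e β c`.
  have hcard : #{y : Λ | y < x ∧ e β y < e β c} < κ := by
    refine lt_of_le_of_lt (mk_le_of_injective
      (f := fun y : {y : Λ | y < x ∧ e β y < e β c} => (⟨e β y, y.2.2⟩ : Iio (e β c))) ?_)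
      (hDseg (e β c))
    intro y z hyz
    exact Subtype.ext (he β (y.2.1.trans hβ) (z.2.1.trans hβ) (congrArg Subtype.val hyz))
  obtain ⟨ε, hε, h⟩ := hx _ (fun y hy => hy.1) hcard
  refine ⟨ε, hε, fun α hα hαx => ?_⟩
  have hm := walkStep_mem e (hαx.trans hβ)
  have hle := walkStep_le e (hαx.trans hβ) (γ := c) ⟨hαx.le.trans hcm.1, hcm.2⟩
  refine he β hm.2 hcm.2 (hle.antisymm ?_)
  by_contra! hlt
  rcases lt_or_ge (walkStep e β α (hαx.trans hβ)) x with hlx | hge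
  · exact absurd ((h _ ⟨hlx, hlt⟩).trans hα) (not_lt.mpr hm.1)
  · exact absurd (walkStep_le e hβ ⟨hge, hm.2⟩) (not_le.mpr hlt)

/-- Walks to points just below a point `x` of high cofinality pass through `x`. -/
theorem walk_append_of_highCof [WellFoundedLT Λ] {κ : Cardinal.{u}} (hκ : 0 < κ) (hDseg : ∀ d : D, #(Iio d) < κ)
    {e : Λ → Λ → D} (he : ∀ x, InjOn (e x) (Iio x)) {x : Λ} (hx : x ∈ highCof κ Λ) (β : Λ)
    (hβ : x ≤ β) :
    ∃ ε < x, ∀ α, ε < α → α < x → walk e β α = walk e β x ++ walk e x α := by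
  induction β using WellFoundedLT.induction with
  | ind β ih =>
    rcases hβ.eq_or_lt with rfl | hlt
    · obtain ⟨ε, hε⟩ := exists_lt_of_mem_highCof hκ hx
      exact ⟨ε, hε, fun α _ _ => by rw [walk_self, List.nil_append]⟩
    · have hm := walkStep_mem e hlt
      obtain ⟨ε₁, hε₁, h₁⟩ := ih _ hm.2 hm.1
      obtain ⟨ε₂, hε₂, h₂⟩ := walkStep_eq_of_highCof hDseg he hx hlt
      refine ⟨max ε₁ ε₂, max_lt hε₁ hε₂, fun α hα hαx => ?_⟩
      rw [max_lt_iff] at hα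
      rw [walk_of_lt e (hαx.trans hlt), walk_of_lt e hlt, h₂ α hα.2 hαx, h₁ α hα.1 hαx,
        List.cons_append]

end Walks

/-! ### The first maximum of a label along a list -/

section Anchor

variable {X Θ : Type*} [LinearOrder Θ]

open Classical in
/-- The position of the first entry of `l` at which `g` is maximal. -/
noncomputable def anchor (g : X → Θ) (l : List X) : ℕ :=
  l.findIdx (fun y => decide (∀ z ∈ l, g z ≤ g y))

/-- If `g` exceeds its values on `A` and `B` somewhere on `K`, its first maximum on `A ++ K ++ B`
is its first maximum on `K`. -/
theorem anchor_append {g : X → Θ} {A K B : List X} {m : X} (hm : m ∈ K)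
    (hA : ∀ y ∈ A, g y < g m) (hB : ∀ y ∈ B, g y < g m) :
    anchor g (A ++ (K ++ B)) = A.length + anchor g K := by
  classical
  have hiff : ∀ y ∈ K, (∀ z ∈ A ++ (K ++ B), g z ≤ g y) ↔ ∀ z ∈ K, g z ≤ g y := by
    intro y _
    refine ⟨fun h z hz => h z (by simp [hz]), fun h z hz => ?_⟩
    simp only [List.mem_append] at hz
    rcases hz with hz | hz | hz
    · exact (hA z hz).le.trans (h m hm)
    · exact h z hz
    · exact (hB z hz).le.trans (h m hm)
  have hAf : A.findIdx (fun y => decide (∀ z ∈ A ++ (K ++ B), g z ≤ g y)) = A.length := by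
    rw [List.findIdx_eq_length]
    intro y hy
    simp only [decide_eq_false_iff_not]
    exact fun h => absurd (h m (by simp [hm])) (not_le.mpr (hA y hy))
  have hK : anchor g K < K.length := by
    rw [anchor, List.findIdx_lt_length]
    obtain ⟨y, hy, hmax⟩ := K.toFinset.exists_max_image g ⟨m, by simpa using hm⟩
    exact ⟨y, by simpa using hy, by simpa using hmax⟩
  have hKf : K.findIdx (fun y => decide (∀ z ∈ A ++ (K ++ B), g z ≤ g y)) = anchor g K := by
    rw [List.findIdx_eq hK]
    have h0 := (List.findIdx_eq hK).mp (rfl : anchor g K = anchor g K)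
    refine ⟨?_, fun j hj => ?_⟩
    · have := h0.1
      simp only [decide_eq_true_eq] at this ⊢
      exact (hiff _ (List.getElem_mem hK)).mpr this
    · have := h0.2 j hj
      simp only [decide_eq_false_iff_not] at this ⊢
      exact fun h => this ((hiff _ (List.getElem_mem _)).mp h)
  rw [anchor, List.findIdx_append, hAf, if_neg (lt_irrefl _), List.findIdx_append, hKf, if_pos hK,
    add_comm]

/-- The entry of `l` that lies `n.1 - n.2` places after the first maximum of `g`. The pair `n` encodes
an integer offset; the value `d` is returned when the position lies beyond the end of `l`. -/
noncomputable def anchored (g : X → Θ) (n : ℕ × ℕ) (l : List X) (d : X) : X :=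
  l.getD (anchor g l + n.1 - n.2) d

/-- An entry `m` of `K` is found at a fixed offset from the first maximum of `g`, in all extensions of
`K` on both sides by entries with labels below `g m`. -/
theorem exists_anchored_append {g : X → Θ} {K : List X} {m : X} (hm : m ∈ K) :
    ∃ n : ℕ × ℕ, ∀ (A B : List X) (x : X), (∀ y ∈ A, g y < g m) → (∀ y ∈ B, g y < g m) →
      anchored g n (A ++ (K ++ B)) x = m := by
  obtain ⟨i, hi, rfl⟩ := List.getElem_of_mem hm
  refine ⟨(i, anchor g K), fun A B x hA hB => ?_⟩
  have h1 : A.length + anchor g K + i - anchor g K = A.length + i := by omega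
  rw [anchored, anchor_append hm hA hB]
  simp only [h1]
  rw [List.getD_append_right _ _ _ _ (by omega), Nat.add_sub_cancel_left,
    List.getD_append _ _ _ _ hi, List.getD_eq_getElem _ _ hi]

end Anchor

/-! ### The colouring -/

section Coloring

variable {Λ D Θ : Type u} [LinearOrder D] [WellFoundedLT D]
  [LinearOrder Θ]

theorem exists_bound_on_lists {θ : Cardinal.{u}} (hθ : θ.IsRegular) (hθ' : ℵ₀ < θ)
    (hΘ : StrictlyDirected θ Θ) (g : Λ → Θ) (s : Set Λ) (hs : #s < θ) (l : Λ → List Λ) :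
    ∃ b, ∀ α ∈ s, ∀ y ∈ l α, g y < b := by
  have hcard : #(⋃ α : s, {y | y ∈ l α}) < θ := by
    rw [card_iUnion_lt_iff_forall_of_isRegular hθ hs]
    exact fun α => ((l α).finite_toSet.lt_aleph0).trans hθ'
  obtain ⟨b, hb⟩ := hΘ (⋃ α : s, {y | y ∈ l α} : Set Λ) (fun y => g y) hcard
  exact ⟨b, fun α hα y hy => hb ⟨y, mem_iUnion.mpr ⟨⟨α, hα⟩, hy⟩⟩⟩

/-- For each family `s` and each colour `j` there is an offset `n` for which the colouring by `h` at
offset `n` from the first maximum of `g` on the walk is constantly `j` on some `s y × s μ` with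
`F y < μ`. -/
theorem exists_anchored_color [LinearOrder Λ] [WellFoundedLT Λ] {κ θ : Cardinal.{u}} (hθ : θ.IsRegular)
    (hθ' : ℵ₀ < θ) (hθκ : θ < κ) (hΛ : StrictlyDirected (Order.succ κ) Λ)
    (hDseg : ∀ d : D, #(Iio d) < κ) (hΘ : StrictlyDirected θ Θ) (hΘcard : #Θ = θ)
    (hS : MeetsClosure (highCof κ Λ)) {e : Λ → Λ → D} (he : ∀ x, InjOn (e x) (Iio x))
    {g : Λ → Θ} {h : Λ → Λ}
    (hgh : ∀ ζ j, MeetsClosure {x ∈ highCof κ Λ | g x = ζ ∧ h x = j})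
    (s : Λ → Set Λ) (hs : ∀ y, #(s y) < θ) (hsy : ∀ y, s y ⊆ Ioi y) (F : Λ → Λ) (j : Λ) :
    ∃ (n : ℕ × ℕ) (y μ : Λ), F y < μ ∧ ∀ α ∈ s y, ∀ β ∈ s μ, α < β ∧
      h (anchored g n (walk e β α) β) = j := by
  have hκ0 : 0 < κ := (aleph0_pos.trans hθ').trans hθκ
  have hpos : ∀ x ∈ highCof κ Λ, ∃ y, y < x := fun x hx => exists_lt_of_mem_highCof hκ0 hx
  have hΘκ : #Θ ≤ κ := hΘcard.trans_le hθκ.le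
  -- `F'` bounds both `F` and the elements of the family.
  have hF' : ∀ y, ∃ w, F y < w ∧ ∀ α ∈ s y, α < w := by
    intro y
    obtain ⟨w, hw⟩ := hΛ.set (s y) (((hs y).trans hθκ).trans (Order.lt_succ κ))
    obtain ⟨w', hw'⟩ := hΛ PUnit (fun _ => max (F y) w)
      (by simpa using one_lt_aleph0.trans ((hθ'.trans hθκ).trans (Order.lt_succ κ)))
    have := max_lt_iff.mp (hw' ⟨⟩)
    exact ⟨w', this.1, fun α hα => (hw α hα).trans this.2⟩
  choose F' hF' hF's using hF'
  -- Upper points: `μ` with small labels on the walks from `s μ` to `μ`.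
  have hup : ∃ (b : Θ) (ε : Λ), ∀ z, ∃ μ, z < μ ∧ (∀ β ∈ s μ, ∀ y ∈ walk e β μ, g y < b) ∧
      ∀ β ∈ s μ, ∀ α, ε < α → α < μ → walk e β α = walk e β μ ++ walk e μ α := by
    choose b hb using fun μ => exists_bound_on_lists hθ hθ' hΘ g (s μ) (hs μ) (fun β => walk e β μ)
    have hε : ∀ μ, ∃ ε, μ ∈ highCof κ Λ → ε < μ ∧
        ∀ β ∈ s μ, ∀ α, ε < α → α < μ → walk e β α = walk e β μ ++ walk e μ α := by
      intro μ
      by_cases hμ : μ ∈ highCof κ Λ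
      · choose ε hε h using fun β : s μ =>
          walk_append_of_highCof hκ0 hDseg he hμ β.1 (hsy μ β.2).le
        obtain ⟨ε', hε', hlt⟩ := highCof_family hμ ε ((hs μ).trans hθκ) hε
        exact ⟨ε', fun _ => ⟨hε', fun β hβ α hα hαμ => h ⟨β, hβ⟩ α ((hlt _).trans hα) hαμ⟩⟩
      · exact ⟨μ, fun h => absurd h hμ⟩
    choose φ hφ using hε
    obtain ⟨i, ε, hiε⟩ := hS.exists_unbounded hΛ hΘκ b φ (fun x hx => (hφ x hx).1)
    refine ⟨i, ε, fun z => ?_⟩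
    obtain ⟨μ, hμ, hzμ, rfl, rfl⟩ := hiε z
    exact ⟨μ, hzμ, hb μ, (hφ μ hμ).2⟩
  -- Lower points: `x` with small labels on the walks from `x` to `s y`, for cofinally many `y < x`.
  have hlow : ∃ b : Θ, ∀ z, ∃ x ∈ highCof κ Λ, z < x ∧ (∀ y < x, F' y < x) ∧
      ∀ z' < x, ∃ y, z' < y ∧ y < x ∧ ∀ α ∈ s y, ∀ w ∈ walk e x α, g w < b := by
    have hb : ∀ x, ∃ b : Θ, x ∈ highCof κ Λ →
        ∀ z' < x, ∃ y, z' < y ∧ y < x ∧ ∀ α ∈ s y, ∀ w ∈ walk e x α, g w < b := by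
      intro x
      -- Otherwise each `b` fails above some `z b < x`. The `z b` are fewer than `κ`, so some `y < x`
      -- lies above all of them, although the labels belonging to `y` do have a bound.
      by_contra! hc
      obtain ⟨b₀, -⟩ := hΘ.set ∅ (by simpa using aleph0_pos.trans hθ')
      have hx := (hc b₀).1
      choose z hzx hz using fun b => (hc b).2
      obtain ⟨y, hy, hzy⟩ := highCof_family hx z (hΘcard.trans_lt hθκ) hzx
      obtain ⟨b, hb⟩ := exists_bound_on_lists hθ hθ' hΘ g (s y) (hs y) (fun α => walk e x α)
      obtain ⟨α, hα, w, hw, hbw⟩ := hz b y (hzy b) hy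
      exact absurd (hb α hα w hw) (not_lt.mpr hbw)
    choose b hb using hb
    obtain ⟨i, hi⟩ := hS.exists_fiber hΛ hΘκ b
    refine ⟨i, fun z => ?_⟩
    obtain ⟨x, ⟨hx, rfl⟩, hzx, hFx⟩ := hi.exists_gt (fun x hx => hpos x hx.1) F' z
    exact ⟨x, hx, hzx, hFx, hb x hx⟩
  obtain ⟨b₁, ε, hup⟩ := hup
  obtain ⟨b₂, hlow⟩ := hlow
  choose H hHS hH hHF hHy using hlow
  -- The point `m` carries the maximal label and the colour.
  obtain ⟨m, ⟨hmS, hgm, hhm⟩, hεm, hHm⟩ :=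
    (hgh (max b₁ b₂) j).exists_gt (fun x hx => hpos x hx.1) H ε
  obtain ⟨μ, hmμ, hμb, hμw⟩ := hup m
  obtain ⟨ε₁, hε₁, hw₁⟩ := walk_append_of_highCof hκ0 hDseg he hmS μ hmμ.le
  set z := max ε ε₁ with hz
  have hxm : H z < m := hHm z (max_lt hεm hε₁)
  have hzx : z < H z := hH z
  obtain ⟨ε₂, hε₂, hw₂⟩ := walk_append_of_highCof hκ0 hDseg he (hHS z) m hxm.le
  obtain ⟨y, hy, hyx, hyb⟩ := hHy z (max z ε₂) (max_lt hzx hε₂)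
  have hy₁ := max_lt_iff.mp hy
  have hy₂ := max_lt_iff.mp (hz ▸ hy₁.1)
  have hmem : m ∈ walk e μ m ++ walk e m (H z) := by
    rw [walk_of_lt e hxm]; simp
  obtain ⟨n, hn⟩ := exists_anchored_append (g := g) hmem
  refine ⟨n, y, μ, (hF' y).trans ((hHF z y hyx).trans (hxm.trans hmμ)), fun α hα β hβ => ?_⟩
  have hyα : y < α := hsy y hα
  have hαx : α < H z := (hF's y α hα).trans (hHF z y hyx)
  refine ⟨((hαx.trans hxm).trans hmμ).trans (hsy μ hβ), ?_⟩
  have hsplit : walk e β α =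
      walk e β μ ++ ((walk e μ m ++ walk e m (H z)) ++ walk e (H z) α) := by
    rw [hμw β hβ α (hy₂.1.trans hyα) ((hαx.trans hxm).trans hmμ),
      hw₁ α (hy₂.2.trans hyα) (hαx.trans hxm), hw₂ α (hy₁.2.trans hyα) hαx, List.append_assoc]
  rw [hsplit, hn _ _ _ (fun w hw => ?_) (fun w hw => ?_), hhm]
  · exact (hμb β hβ w hw).trans_le (hgm ▸ le_max_left _ _)
  · exact (hyb α hα w hw).trans_le (hgm ▸ le_max_right _ _)

/-- Of a pairwise disjoint family, at most `κ` members meet `Iic y`. -/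
theorem exists_index_above [LinearOrder Λ] {κ : Cardinal.{u}} (hκ : ℵ₀ ≤ κ) (hΛcard : #Λ = Order.succ κ)
    (hseg : ∀ x : Λ, #(Iio x) ≤ κ) (t : Λ → Set Λ)
    (ht : ∀ α β, α ≠ β → Disjoint (t α) (t β)) (y : Λ) : ∃ α, y < α ∧ t α ⊆ Ioi y := by
  have hy : #(Iic y) ≤ κ := by
    rw [← Iio_insert]
    exact (mk_insert_le).trans ((add_le_add_left (hseg y) 1).trans (by rw [add_one_eq hκ]))
  by_contra! hc
  have hbad : ∀ α : Ioi y, ∃ z ∈ t α, z ≤ y := by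
    intro α
    by_contra! h
    exact hc α α.2 fun z hz => h z hz
  choose z hz hzy using hbad
  have hinj : Function.Injective (fun α => (⟨z α, hzy α⟩ : Iic y)) := by
    intro α β hαβ
    by_contra hne
    have hzz : z α = z β := congrArg Subtype.val hαβ
    exact disjoint_left.mp (ht α β (fun h => hne (Subtype.ext h))) (hz α) (hzz ▸ hz β)
  have h1 : #(Ioi y) ≤ κ := (mk_le_of_injective hinj).trans hy
  have h2 : #Λ ≤ κ := by
    rw [← mk_univ, ← Iic_union_Ioi (a := y)]
    exact (mk_union_le _ _).trans (add_le_of_le hκ hy h1)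
  rw [hΛcard] at h2
  exact absurd (Order.lt_succ κ) (not_lt.mpr h2)

/-- Countably many colourings which together handle all families can be merged into one: for each
colour a single index serves all families, since otherwise the union of one bad family for each
index would be bad for all indices. -/
theorem exists_uniform_coloring [LinearOrder Λ] {κ θ : Cardinal.{u}} (hθ : θ.IsRegular)
    (hθ' : ℵ₀ < θ) (hθκ : θ < κ) (hΛ : StrictlyDirected (Order.succ κ) Λ)
    (hΛcard : #Λ = Order.succ κ) (hseg : ∀ x : Λ, #(Iio x) ≤ κ) {N : Type} [Countable N]
    (c : N → Λ → Λ → Λ)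
    (hc : ∀ (s : Λ → Set Λ), (∀ y, #(s y) < θ) → (∀ y, s y ⊆ Ioi y) → ∀ (F : Λ → Λ) (j : Λ),
      ∃ (n : N) (y μ : Λ), F y < μ ∧ ∀ α ∈ s y, ∀ β ∈ s μ, α < β ∧ c n β α = j) :
    ∃ C : Λ → Λ → Λ, ∀ t : Λ → Set Λ, (∀ α, #(t α) < θ) →
      (∀ α β, α ≠ β → Disjoint (t α) (t β)) → ∀ j, ∃ α₀ α₁, α₀ < α₁ ∧
        ∀ ζ₀ ∈ t α₀, ∀ ζ₁ ∈ t α₁, ζ₀ < ζ₁ ∧ C ζ₁ ζ₀ = j := by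
  have hκ : ℵ₀ ≤ κ := (hθ'.trans hθκ).le
  have hN : ∀ j, ∃ n, ∀ t : Λ → Set Λ, (∀ α, #(t α) < θ) →
      (∀ α β, α ≠ β → Disjoint (t α) (t β)) → ∃ α₀ α₁, α₀ < α₁ ∧
        ∀ ζ₀ ∈ t α₀, ∀ ζ₁ ∈ t α₁, ζ₀ < ζ₁ ∧ c n ζ₁ ζ₀ = j := by
    intro j
    by_contra! hcon
    -- One bad family for each index; their union, re-indexed to lie above its index, is bad for all.
    choose t htc htd hbad using hcon
    choose I hI hIt using fun n y => exists_index_above hκ hΛcard hseg (t n) (htd n) y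
    have hNcard : #(ULift.{u} N) < θ := (mk_le_aleph0 (α := ULift.{u} N)).trans_lt hθ'
    choose F hF using fun y => hΛ (ULift.{u} N) (fun n => I n.down y)
      (hNcard.trans (hθκ.trans (Order.lt_succ κ)))
    obtain ⟨n, y, μ, hyμ, h⟩ := hc (fun y => ⋃ n : ULift.{u} N, t n.down (I n.down y))
      (fun y => (card_iUnion_lt_iff_forall_of_isRegular hθ hNcard).mpr fun n => htc _ _)
      (fun y => iUnion_subset fun n => hIt _ _) F j
    obtain ⟨ζ₀, h₀, ζ₁, h₁, hne⟩ := hbad n (I n y) (I n μ)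
      (((hF y ⟨n⟩).trans hyμ).trans (hI n μ))
    obtain ⟨hlt, hcol⟩ := h ζ₀ (mem_iUnion.mpr ⟨⟨n⟩, h₀⟩) ζ₁ (mem_iUnion.mpr ⟨⟨n⟩, h₁⟩)
    exact hne hlt hcol
  choose n hn using hN
  have hreg := isRegular_succ hκ
  obtain ⟨i, hi⟩ := infinite_pigeonhole (fun j => ULift.up.{u} (n j))
    (by rw [hΛcard]; exact hreg.aleph0_le)
    (by rw [hΛcard, hreg.cof_ord]
        exact (mk_le_aleph0 (α := ULift.{u} N)).trans_lt (Order.lt_succ_iff.mpr hκ))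
  -- `E` renames the colours that are served by the common index.
  obtain ⟨E⟩ := Cardinal.eq.mp hi
  classical
  refine ⟨fun β α => if h : c i.down β α ∈ (fun j => ULift.up.{u} (n j)) ⁻¹' {i}
    then E ⟨_, h⟩ else β, fun t ht htd j => ?_⟩
  have hj : n (E.symm j).1 = i.down := congrArg ULift.down (E.symm j).2
  obtain ⟨α₀, α₁, hlt, h⟩ := hn (E.symm j).1 t ht htd
  refine ⟨α₀, α₁, hlt, fun ζ₀ h₀ ζ₁ h₁ => ⟨(h ζ₀ h₀ ζ₁ h₁).1, ?_⟩⟩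
  have hcol := (h ζ₀ h₀ ζ₁ h₁).2
  rw [hj] at hcol
  simp only [hcol, dif_pos (E.symm j).2, Subtype.coe_eta, Equiv.apply_symm_apply]

end Coloring

/-! ### The theorem -/

/-- The formulation by sets for a single family `t`, where `C` takes the larger point of a pair as its
first argument. -/
theorem exists_coloring_toType {κ θ : Cardinal.{u}} (hκ : κ.IsRegular) (hθ : θ.IsRegular)
    (hθ' : ℵ₀ < θ) (hθκ : θ < κ) :
    ∃ C : (Order.succ κ).ord.ToType → (Order.succ κ).ord.ToType → (Order.succ κ).ord.ToType,
      ∀ t : (Order.succ κ).ord.ToType → Set (Order.succ κ).ord.ToType, (∀ α, #(t α) < θ) →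
      (∀ α β, α ≠ β → Disjoint (t α) (t β)) → ∀ j, ∃ α₀ α₁, α₀ < α₁ ∧
        ∀ ζ₀ ∈ t α₀, ∀ ζ₁ ∈ t α₁, ζ₀ < ζ₁ ∧ C ζ₁ ζ₀ = j := by
  have hreg := isRegular_succ hκ.aleph0_le
  have hΛ := strictlyDirected_toType hreg
  have hΘ := strictlyDirected_toType hθ
  have hΛcard : #(Order.succ κ).ord.ToType = Order.succ κ := mk_ord_toType _
  have hseg : ∀ x : (Order.succ κ).ord.ToType, #(Iio x) ≤ κ := fun x =>
    Order.lt_succ_iff.mp (by simpa using mk_Iio_lt x (by simp))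
  have hDseg : ∀ d : κ.ord.ToType, #(Iio d) < κ := fun d => by simpa using mk_Iio_lt d (by simp)
  have : Nonempty θ.ord.ToType := by
    rw [← mk_ne_zero_iff, mk_ord_toType]; exact hθ.ne_zero
  have : Nonempty κ.ord.ToType := by
    rw [← mk_ne_zero_iff, mk_ord_toType]; exact hκ.ne_zero
  have he : ∀ x : (Order.succ κ).ord.ToType,
      ∃ f : (Order.succ κ).ord.ToType → κ.ord.ToType, InjOn f (Iio x) := by
    intro x
    have : #(Iio x) ≤ #κ.ord.ToType := by rw [mk_ord_toType]; exact hseg x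
    obtain ⟨f⟩ := this
    classical
    refine ⟨fun y => if h : y < x then f ⟨y, h⟩ else Classical.arbitrary _, fun y hy z hz hyz => ?_⟩
    simp only [dif_pos (show y < x from hy), dif_pos (show z < x from hz)] at hyz
    exact congrArg Subtype.val (f.injective hyz)
  choose e he using he
  have hS := meetsClosure_highCof hκ.aleph0_le hΛ hseg (strictlyDirected_toType hκ)
    (mk_ord_toType κ) hDseg
  obtain ⟨g, h, hgh⟩ := hS.exists_two_labels (Θ := θ.ord.ToType) hκ.aleph0_le hΛ hΛcard
    (mk_ord_toType κ).le e he ((mk_ord_toType θ).trans_le hθκ.le)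
    (fun x hx => exists_lt_of_mem_highCof hκ.pos hx)
  exact exists_uniform_coloring hθ hθ' hθκ hΛ hΛcard hseg
    (fun n β α => h (anchored g n (walk e β α) β))
    (fun s hs hsy F j => exists_anchored_color hθ hθ' hθκ hΛ hDseg hΘ (mk_ord_toType θ) hS he hgh
      s hs hsy F j)

theorem theorem2p5 (lam del th0 th1 : Cardinal.{u})
    (hlam : lam = Order.succ del)
    (hdel : del.IsRegular) (hth1 : th1.IsRegular) (hth0 : th0.IsRegular)
    (h1 : th1 < del) (h01 : th0 < th1) :
    PrOne lam lam lam th0 th1 ∧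
    ∃ c : UnorderedPairs lam.ord.ToType → lam.ord.ToType,
      ∀ t₀ t₁ : lam.ord.ToType → Set lam.ord.ToType,
        (∀ α, Cardinal.mk (t₀ α) < th0) →
        (∀ α, Cardinal.mk (t₁ α) < th1) →
        (∀ α β, α ≠ β → Disjoint (t₀ α ∪ t₁ α) (t₀ β ∪ t₁ β)) →
        ∀ j : lam.ord.ToType,
          ∃ α₀ α₁ : lam.ord.ToType, α₀ < α₁ ∧
            ∀ ζ₀ ∈ t₀ α₀, ∀ ζ₁ ∈ t₁ α₁,
              ∃ h : ζ₀ ≠ ζ₁, c (unorderedPair ζ₀ ζ₁ h) = j := by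
  subst hlam
  have hunc : ℵ₀ < th1 := hth0.aleph0_le.trans_lt h01
  obtain ⟨C, hC⟩ := exists_coloring_toType hdel hth1 hunc h1
  have key : ∃ c : UnorderedPairs (Order.succ del).ord.ToType → (Order.succ del).ord.ToType,
      ∀ t₀ t₁ : (Order.succ del).ord.ToType → Set (Order.succ del).ord.ToType,
        (∀ α, Cardinal.mk (t₀ α) < th0) →
        (∀ α, Cardinal.mk (t₁ α) < th1) →
        (∀ α β, α ≠ β → Disjoint (t₀ α ∪ t₁ α) (t₀ β ∪ t₁ β)) →
        ∀ j : (Order.succ del).ord.ToType,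
          ∃ α₀ α₁ : (Order.succ del).ord.ToType, α₀ < α₁ ∧
            ∀ ζ₀ ∈ t₀ α₀, ∀ ζ₁ ∈ t₁ α₁,
              ∃ h : ζ₀ ≠ ζ₁, c (unorderedPair ζ₀ ζ₁ h) = j := by
    refine ⟨fun p => C p.1.sup p.1.inf, fun t₀ t₁ ht₀ ht₁ hd j => ?_⟩
    obtain ⟨α₀, α₁, hlt, h⟩ := hC (fun α => t₀ α ∪ t₁ α)
      (fun α => (mk_union_le _ _).trans_lt
        (add_lt_of_lt hth1.aleph0_le ((ht₀ α).trans h01) (ht₁ α))) hd j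
    refine ⟨α₀, α₁, hlt, fun ζ₀ h₀ ζ₁ h₁ => ?_⟩
    obtain ⟨hζ, hcol⟩ := h ζ₀ (Or.inl h₀) ζ₁ (Or.inr h₁)
    refine ⟨hζ.ne, ?_⟩
    simp only [unorderedPair, Sym2.sup_mk, Sym2.inf_mk, sup_eq_right.mpr hζ.le,
      inf_eq_left.mpr hζ.le]
    exact hcol
  refine ⟨?_, key⟩
  obtain ⟨c, hc⟩ := key
  refine ⟨c, fun i₀ i₁ hi₀ hi₁ z₀ z₁ hz₀ hz₁ hz γ => ?_⟩
  have hcard : ∀ (i : Ordinal.{u}) (θ : Cardinal.{u}), i < θ.ord → #i.ToType < θ := by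
    intro i θ hi
    rw [mk_toType]
    exact lt_ord.mp hi
  obtain ⟨α₀, α₁, hlt, h⟩ := hc (fun α => range (z₀ α)) (fun α => range (z₁ α))
    (fun α => mk_range_le.trans_lt (hcard _ _ hi₀)) (fun α => mk_range_le.trans_lt (hcard _ _ hi₁))
    (fun α β hαβ => by
      rw [disjoint_left]
      rintro x (⟨i, rfl⟩ | ⟨i, rfl⟩) (⟨k, hk⟩ | ⟨k, hk⟩)
      · exact hαβ (congrArg Prod.fst (@hz₀ (β, k) (α, i) hk)).symm
      · exact hz _ _ _ _ hk.symm
      · exact hz _ _ _ _ hk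
      · exact hαβ (congrArg Prod.fst (@hz₁ (β, k) (α, i) hk)).symm) γ
  exact ⟨α₀, α₁, hlt, fun j₀ j₁ => h _ (mem_range_self j₀) _ (mem_range_self j₁)⟩
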